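/- Theorem B (Rudin–Carleson). Let $T=\{z\in\mathbb C:|z|=1\}$ and $\Delta=\{z\in\mathbb C:|z|<1\}$, and let the disk algebra $A$ be the algebra of all continuous functions $\overline\Delta\to\mathbb C$ that are analytic on $\Delta$. Let $E$ be a closed subset of $T$ of Lebesgue (arc length) measure zero, and let $f:E\to\mathbb C$ be continuous. Then there is a function $g\in A$ such that $g(z)=f(z)$ for all $z\in E$. Moreover, for every $\eta>0$ one can choose such a $g\in A$, agreeing with $f$ on $E$, with $|g(z)|\le \|f\|_E+\eta$ for all $z\in\overline\Delta$, where $\|f\|_E=\sup_{z\in E}|f(z)|$ (and $\|f\|_E=0$ if $E$ is empty). -/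

import Mathlib

/-- Lebesgue (arc length) measure on the unit circle `{z : ℂ | |z| = 1}`, as a measure on `ℂ`:
the image of Lebesgue measure on `(-π, π]` under `θ ↦ exp (i θ)`. -/
noncomputable def circleLebesgue : MeasureTheory.Measure ℂ :=
  (MeasureTheory.volume.restrict (Set.Ioc (-Real.pi) Real.pi)).map
    (fun θ : ℝ => Complex.exp (θ * Complex.I))

/-- The disk algebra: the continuous functions on the closed unit disk that are analytic
on the open unit disk. -/
def diskAlgebra : Subalgebra ℂ C(Metric.closedBall (0 : ℂ) 1, ℂ) where
  carrier := {g | ∃ G : ℂ → ℂ, AnalyticOnNhd ℂ G (Metric.ball 0 1) ∧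
    ∀ z : Metric.closedBall (0 : ℂ) 1, (z : ℂ) ∈ Metric.ball (0 : ℂ) 1 → g z = G z}
  mul_mem' := by
    rintro a b ⟨F, hF, hF'⟩ ⟨G, hG, hG'⟩
    exact ⟨F * G, hF.mul hG, fun z hz => by simp [hF' z hz, hG' z hz]⟩
  add_mem' := by
    rintro a b ⟨F, hF, hF'⟩ ⟨G, hG, hG'⟩
    exact ⟨F + G, hF.add hG, fun z hz => by simp [hF' z hz, hG' z hz]⟩
  algebraMap_mem' := fun c => ⟨fun _ => c, analyticOnNhd_const, fun _ _ => by simp⟩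

/-- The sup norm `sup {|f z| : z ∈ E}` of a function on `E` (it is `0` for empty `E`; for
a continuous function on a compact set the supremum is over a bounded set). -/
noncomputable def supNorm {E : Set ℂ} (f : E → ℂ) : ℝ := ⨆ z : E, ‖f z‖

open Metric Filter MeasureTheory
open scoped Topology NNReal ENNReal ComplexConjugate

/-! Restriction from the disk algebra `A` to `C(E)` is shown to be onto with almost no loss of norm.
As `E` misses a point of the circle, Stone–Weierstrass makes `A|E` dense
(`topologicalClosure_map_restrictCircle`), but an approximant `p` of `f` may be large off `E`. As
`E` is null, `exists_peak` gives `h` in `A` with `|h| ≤ 1`, close to `1` on `E` and small away from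
`E`. Then `p * h` still approximates `f` on `E`; its norm is at most `‖f‖ + δ`, since near `E`
continuity compares `p` with `f` and elsewhere `h` damps `p`. Successive approximation in the closed
algebra `A` (`exists_preimage_of_approx`) turns this into exact interpolation. -/

instance : IsFiniteMeasure circleLebesgue := by
  unfold circleLebesgue; infer_instance

/-! ### Arc length and economical covers of null sets -/

theorem measurable_exp_mul_I : Measurable (fun θ : ℝ => Complex.exp (θ * Complex.I)) := by
  fun_prop

theorem dist_exp_mul_I_le (s t : ℝ) :
    dist (Complex.exp (s * Complex.I)) (Complex.exp (t * Complex.I)) ≤ |s - t| := by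
  have h : Complex.exp (s * Complex.I) - Complex.exp (t * Complex.I) =
      Complex.exp (t * Complex.I) * (Complex.exp (Complex.I * ((s - t : ℝ) : ℂ)) - 1) := by
    rw [mul_sub, ← Complex.exp_add, mul_one]
    congr 2
    push_cast
    ring
  rw [dist_eq_norm, h, norm_mul, Complex.norm_exp_ofReal_mul_I, one_mul]
  exact Real.norm_exp_I_mul_ofReal_sub_one_le

theorem ofReal_le_circleLebesgue_ball {ζ : ℂ} (hζ : ‖ζ‖ = 1) {ρ : ℝ} (h0 : 0 < ρ)
    (hρ : ρ ≤ Real.pi) : ENNReal.ofReal ρ ≤ circleLebesgue (ball ζ ρ) := by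
  have hexp : Complex.exp (ζ.arg * Complex.I) = ζ := by
    have := Complex.norm_mul_exp_arg_mul_I ζ
    simpa [hζ] using this
  have h1 := Complex.neg_pi_lt_arg ζ
  have h2 := Complex.arg_le_pi ζ
  rw [circleLebesgue, Measure.map_apply measurable_exp_mul_I measurableSet_ball,
    Measure.restrict_apply (measurable_exp_mul_I measurableSet_ball)]
  have key : ∀ a : ℝ, -Real.pi ≤ a → a + ρ ≤ Real.pi → (∀ t ∈ Set.Ioo a (a + ρ), |t - ζ.arg| < ρ) →
      ENNReal.ofReal ρ ≤ volume ((fun θ : ℝ => Complex.exp (θ * Complex.I)) ⁻¹' ball ζ ρ ∩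
        Set.Ioc (-Real.pi) Real.pi) := by
    intro a ha hb h
    have : volume (Set.Ioo a (a + ρ)) = ENNReal.ofReal ρ := by simp
    rw [← this]
    refine measure_mono fun t ht => ⟨?_, by linarith [ht.1], by linarith [ht.2]⟩
    have := dist_exp_mul_I_le t ζ.arg
    rw [hexp] at this
    exact this.trans_lt (h t ht)
  -- The interval of length `ρ` starting at `arg ζ` and pointing towards `0` stays in `[-π, π]`, so
  -- no wrap-around at the cut occurs.
  rcases lt_or_ge 0 ζ.arg with h | h
  · refine key (ζ.arg - ρ) (by linarith) (by linarith) fun t ht => ?_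
    rw [abs_lt]; constructor <;> linarith [ht.1, ht.2]
  · refine key ζ.arg (by linarith) (by linarith) fun t ht => ?_
    rw [abs_lt]; constructor <;> linarith [ht.1, ht.2]

theorem exists_mem_sphere_notMem {E : Set ℂ} (hE0 : circleLebesgue E = 0) :
    ∃ a ∈ sphere (0 : ℂ) 1, a ∉ E := by
  by_contra! h
  have h1 : circleLebesgue (sphere 0 1) = 0 := measure_mono_null h hE0
  rw [circleLebesgue, Measure.map_apply measurable_exp_mul_I isClosed_sphere.measurableSet] at h1
  have h2 : (fun θ : ℝ => Complex.exp (θ * Complex.I)) ⁻¹' sphere 0 1 = Set.univ := by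
    ext; simp [Complex.norm_exp_ofReal_mul_I]
  rw [h2] at h1
  have := Real.pi_pos
  simp at h1
  linarith

/-- A compact null subset of the unit circle is covered by finitely many disks of equal radius,
centred in the set, with small total radius. -/
theorem exists_finset_cover {E : Set ℂ} (hET : E ⊆ sphere (0 : ℂ) 1) (hE : IsClosed E)
    (hE0 : circleLebesgue E = 0) {ε ρ : ℝ} (hε : 0 < ε) (hρ : 0 < ρ) :
    ∃ r : ℝ, 0 < r ∧ r < ρ ∧ ∃ s : Finset ℂ, (s : Set ℂ) ⊆ E ∧
      (∀ z ∈ E, ∃ ζ ∈ s, ‖z - ζ‖ ≤ r) ∧ s.card * r ≤ ε := by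
  have hEc : IsCompact E := (isCompact_sphere 0 1).of_isClosed_subset hE hET
  have ht := tendsto_measure_cthickening_of_isCompact (μ := circleLebesgue) hEc
  rw [hE0] at ht
  -- The closed neighbourhoods of `E` shrink to `E`, so their measures tend to `0`. The bound `r <
  -- 1` keeps `r / 2` below `π`.
  have hev : ∀ᶠ r in 𝓝[>] (0 : ℝ),
      circleLebesgue (cthickening r E) < ENNReal.ofReal (ε / 2) ∧ r < min ρ 1 ∧ 0 < r := by
    refine ((ht.eventually_lt_const (by simpa using hε)).filter_mono nhdsWithin_le_nhds).and
      ((eventually_nhdsWithin_of_eventually_nhds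
        (eventually_lt_nhds (lt_min hρ one_pos))).and self_mem_nhdsWithin)
  obtain ⟨r, hr, hrρ, hr0⟩ := hev.exists
  refine ⟨r, hr0, hrρ.trans_le (min_le_left _ _), ?_⟩
  lift r to ℝ≥0 using hr0.le
  have hr0' : 0 < r := hr0
  have hpack : packingNumber r E ≠ ⊤ := by
    obtain ⟨N, -, hNf, hN⟩ := exists_finite_isCover_of_isCompact (ε := r / 2) (by positivity) hEc
    have h2 := packingNumber_two_mul_le_externalCoveringNumber (r / 2) E
    rw [mul_div_cancel₀ _ two_ne_zero] at h2
    exact ne_top_of_le_ne_top hNf.encard_lt_top.ne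
      (h2.trans (IsCover.externalCoveringNumber_le_encard hN))
  -- Maximality gives the cover. Separation makes the balls of radius `r / 2` disjoint; each has
  -- mass at least `r / 2`, and all lie in a set of mass below `ε / 2`.
  set S := maximalSeparatedSet r E with hS
  have hSE : S ⊆ E := maximalSeparatedSet_subset
  have hSfin : S.Finite := by
    rw [← Set.encard_ne_top_iff, encard_maximalSeparatedSet hpack]; exact hpack
  have hcov := (isCover_maximalSeparatedSet hpack).subset_iUnion_closedBall
  have hsep : IsSeparated r S := isSeparated_maximalSeparatedSet
  refine ⟨hSfin.toFinset, by simpa using hSE, fun z hz => ?_, ?_⟩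
  · have := hcov hz
    simp only [Set.mem_iUnion, mem_closedBall, dist_eq_norm] at this
    obtain ⟨ζ, h1, h2⟩ := this
    exact ⟨ζ, by simpa using h1, h2⟩
  · have hdisj : Set.PairwiseDisjoint (hSfin.toFinset : Set ℂ) fun ζ => ball ζ ((r : ℝ) / 2) := by
      intro x hx y hy hxy
      refine ball_disjoint_ball ?_
      have : (r : ℝ≥0∞) < edist x y := hsep (by simpa using hx) (by simpa using hy) hxy
      rw [edist_dist, ← ENNReal.ofReal_coe_nnreal, ENNReal.ofReal_lt_ofReal_iff'] at this
      linarith [this.1]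
    have hsum := measure_biUnion_finset (μ := circleLebesgue) hdisj fun _ _ => measurableSet_ball
    have hle : ∑ ζ ∈ hSfin.toFinset, ENNReal.ofReal ((r : ℝ) / 2) ≤ ENNReal.ofReal (ε / 2) := by
      calc _ ≤ ∑ ζ ∈ hSfin.toFinset, circleLebesgue (ball ζ ((r : ℝ) / 2)) := by
            refine Finset.sum_le_sum fun ζ hζ => ofReal_le_circleLebesgue_ball ?_ (by positivity) ?_
            · simpa using hET (hSE (by simpa using hζ))
            · have := hrρ.trans_le (min_le_right _ _)
              linarith [Real.pi_gt_three]
        _ ≤ circleLebesgue (cthickening r E) := by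
            rw [← hsum]
            refine measure_mono (Set.iUnion₂_subset fun ζ hζ z hz => ?_)
            refine mem_cthickening_of_dist_le z ζ _ _ (hSE (by simpa using hζ)) ?_
            have := mem_ball.1 hz
            linarith
        _ ≤ _ := hr.le
    rw [Finset.sum_const, nsmul_eq_mul, ← ENNReal.ofReal_natCast,
      ← ENNReal.ofReal_mul (by positivity), ENNReal.ofReal_le_ofReal_iff (by positivity)] at hle
    linarith

/-! ### Peak functions -/

theorem one_sub_re_mul_conj_nonneg {z ζ : ℂ} (hz : ‖z‖ ≤ 1) (hζ : ‖ζ‖ = 1) :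
    0 ≤ (1 - z * conj ζ).re := by
  have h : (z * conj ζ).re ≤ 1 := (Complex.re_le_norm _).trans (by simpa [hζ] using hz)
  simpa using h

theorem norm_one_sub_mul_conj {ζ : ℂ} (z : ℂ) (hζ : ‖ζ‖ = 1) : ‖1 - z * conj ζ‖ = ‖z - ζ‖ := by
  have h : 1 - z * conj ζ = -((z - ζ) * conj ζ) := by
    rw [sub_mul, Complex.mul_conj', hζ]; simp
  rw [h, norm_neg, norm_mul, Complex.norm_conj, hζ, mul_one]

/-- For a compact null set `E` on the circle there are functions holomorphic near the closed disk,
bounded by `1`, close to `1` on `E` and close to `0` away from `E`. -/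
theorem exists_peak {E : Set ℂ} (hET : E ⊆ sphere (0 : ℂ) 1) (hE : IsClosed E)
    (hE0 : circleLebesgue E = 0) {d ε : ℝ} (hd : 0 < d) (hε : 0 < ε) :
    ∃ h : ℂ → ℂ, DifferentiableOn ℂ h (closedBall 0 1) ∧ (∀ z ∈ closedBall (0 : ℂ) 1, ‖h z‖ ≤ 1) ∧
      (∀ z ∈ E, ‖h z - 1‖ ≤ ε) ∧
      ∀ z ∈ closedBall (0 : ℂ) 1, (∀ ζ ∈ E, d ≤ ‖z - ζ‖) → ‖h z‖ ≤ ε := by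
  -- With `r < d / 2`, each denominator below is at least `d / 2` at distance `d` from `E`; the
  -- bound on `card * r` then gives `‖F‖ ≤ ε` there, for `K = 4 / ε`.
  obtain ⟨r, hr, hrd, s, hsE, hcov, hcard⟩ := exists_finset_cover hET hE hE0
    (ε := ε ^ 2 * d / 8) (ρ := d / 2) (by positivity) (by positivity)
  have hs1 : ∀ ζ ∈ s, ‖ζ‖ = 1 := fun ζ hζ => by simpa using hET (hsE hζ)
  set K : ℝ := 4 / ε with hK
  have hKpos : 0 < K := by positivity
  -- Each summand has its pole at `(1 + r)ζ`, outside the closed disk, and nonnegative real part on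
  -- the disk. The map `w ↦ w / (1 + w)` sends the right half-plane into the unit disk, large `w`
  -- near `1` and small `w` near `0`.
  set F : ℂ → ℂ := fun z => ((K * r : ℝ) : ℂ) * ∑ ζ ∈ s, (((r : ℝ) : ℂ) + (1 - z * conj ζ))⁻¹ with hF
  have hre : ∀ z ∈ closedBall (0 : ℂ) 1, ∀ ζ ∈ s, r ≤ ((r : ℂ) + (1 - z * conj ζ)).re := by
    intro z hz ζ hζ
    have := one_sub_re_mul_conj_nonneg (by simpa using hz) (hs1 ζ hζ)
    rw [Complex.add_re, Complex.ofReal_re]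
    linarith
  have hne : ∀ z ∈ closedBall (0 : ℂ) 1, ∀ ζ ∈ s, (r : ℂ) + (1 - z * conj ζ) ≠ 0 := by
    intro z hz ζ hζ h0
    have := hre z hz ζ hζ
    rw [h0, Complex.zero_re] at this
    linarith
  have hterm : ∀ z ∈ closedBall (0 : ℂ) 1, ∀ ζ ∈ s, 0 ≤ (((r : ℂ) + (1 - z * conj ζ))⁻¹).re := by
    intro z hz ζ hζ
    rw [Complex.inv_re]
    exact div_nonneg (hr.le.trans (hre z hz ζ hζ)) (Complex.normSq_nonneg _)
  have hFre : ∀ z, (F z).re = K * r * ∑ ζ ∈ s, (((r : ℂ) + (1 - z * conj ζ))⁻¹).re := by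
    intro z
    rw [hF, Complex.re_ofReal_mul, Complex.re_sum]
  have hF0 : ∀ z ∈ closedBall (0 : ℂ) 1, 0 ≤ (F z).re := by
    intro z hz
    rw [hFre]
    exact mul_nonneg (by positivity) (Finset.sum_nonneg (hterm z hz))
  have hden : ∀ z, 1 + (F z).re ≤ ‖1 + F z‖ := fun z => by
    simpa using Complex.re_le_norm (1 + F z)
  have hden0 : ∀ z ∈ closedBall (0 : ℂ) 1, 1 + F z ≠ 0 := by
    intro z hz h0
    have := hden z
    rw [h0, norm_zero] at this
    linarith [hF0 z hz]
  refine ⟨fun z => F z / (1 + F z), ?_, ?_, ?_, ?_⟩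
  · have hFd : DifferentiableOn ℂ F (closedBall 0 1) := by
      refine DifferentiableOn.const_mul (DifferentiableOn.fun_sum fun ζ hζ => ?_) _
      exact DifferentiableOn.inv (by fun_prop) fun z hz => hne z hz ζ hζ
    exact hFd.div (hFd.const_add 1) hden0
  · intro z hz
    rw [norm_div]
    refine div_le_one_of_le₀ ?_ (norm_nonneg _)
    rw [← sq_le_sq₀ (norm_nonneg _) (norm_nonneg _), Complex.sq_norm, Complex.sq_norm,
      Complex.normSq_apply, Complex.normSq_apply]
    have := hF0 z hz
    simp only [Complex.add_re, Complex.add_im, Complex.one_re, Complex.one_im, zero_add]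
    nlinarith
  · intro z hz
    have hzb : z ∈ closedBall (0 : ℂ) 1 := sphere_subset_closedBall (hET hz)
    have h1 : F z / (1 + F z) - 1 = -(1 + F z)⁻¹ := by
      field_simp [hden0 z hzb]
      ring
    obtain ⟨ζ, hζ, hzζ⟩ := hcov z hz
    -- The denominator has real part at least `r` and modulus at most `2r`.
    have h2 : 1 / (4 * r) ≤ (((r : ℂ) + (1 - z * conj ζ))⁻¹).re := by
      have hn : ‖(r : ℂ) + (1 - z * conj ζ)‖ ≤ 2 * r := by
        refine (norm_add_le _ _).trans ?_
        rw [norm_one_sub_mul_conj z (hs1 ζ hζ), Complex.norm_real, Real.norm_of_nonneg hr.le]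
        linarith
      rw [Complex.inv_re, ← Complex.sq_norm, div_le_div_iff₀ (by positivity)
        (by have := norm_pos_iff.2 (hne z hzb ζ hζ); positivity)]
      have := hre z hzb ζ hζ
      have h4 : ‖(r : ℂ) + (1 - z * conj ζ)‖ ^ 2 ≤ (2 * r) ^ 2 := by gcongr
      nlinarith
    have h3 : 1 / ε ≤ (F z).re := by
      rw [hFre]
      calc 1 / ε = K * r * (1 / (4 * r)) := by rw [hK]; field_simp
        _ ≤ _ := by
          gcongr
          exact h2.trans (Finset.single_le_sum (f := fun ζ => (((r : ℂ) + (1 - z * conj ζ))⁻¹).re)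
            (hterm z hzb) hζ)
    rw [h1, norm_neg, norm_inv]
    refine inv_le_of_inv_le₀ hε ?_
    have := hden z
    rw [one_div] at h3
    linarith
  · intro z hz hfar
    have hsum : ‖∑ ζ ∈ s, ((r : ℂ) + (1 - z * conj ζ))⁻¹‖ ≤ s.card * (2 / d) := by
      rw [← nsmul_eq_mul]
      refine norm_sum_le_of_le s (fun ζ hζ => ?_) |>.trans_eq (Finset.sum_const _)
      have h1 : d / 2 ≤ ‖(r : ℂ) + (1 - z * conj ζ)‖ := by
        have h := norm_sub_le_norm_add (1 - z * conj ζ) (r : ℂ)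
        rw [norm_one_sub_mul_conj z (hs1 ζ hζ), Complex.norm_real, Real.norm_of_nonneg hr.le,
          add_comm] at h
        linarith [hfar ζ (hsE hζ)]
      rw [norm_inv]
      refine inv_le_of_inv_le₀ (by positivity) ?_
      rwa [inv_div]
    have hFn : ‖F z‖ ≤ ε := by
      rw [hF, norm_mul, Complex.norm_real, Real.norm_of_nonneg (by positivity)]
      calc K * r * _ ≤ K * r * (s.card * (2 / d)) := by gcongr
        _ = K * (2 / d) * (s.card * r) := by ring
        _ ≤ K * (2 / d) * (ε ^ 2 * d / 8) := by gcongr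
        _ = ε := by rw [hK]; field_simp; norm_num
    rw [norm_div]
    refine (div_le_self (norm_nonneg _) ?_).trans hFn
    linarith [hden z, hF0 z hz]

/-! ### Successive approximation -/

/-- If every `y` is approximately the image of some `x ∈ A` with `‖x‖` not much larger than `‖y‖`,
then `y` is exactly the image of such an `x`. -/
theorem exists_preimage_of_approx {G H : Type*} [NormedAddCommGroup G] [CompleteSpace G]
    [NormedAddCommGroup H] {A : AddSubgroup G} (hA : IsClosed (A : Set G)) (R : G →+ H)
    (hR : Continuous R)
    (happ : ∀ y : H, ∀ δ > 0, ∃ x ∈ A, ‖R x - y‖ ≤ δ ∧ ‖x‖ ≤ ‖y‖ + δ)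
    (y : H) {η : ℝ} (hη : 0 < η) : ∃ x ∈ A, R x = y ∧ ‖x‖ ≤ ‖y‖ + η := by
  choose! T hTA hT hTn using happ
  -- Correction `n + 1` has norm at most `δ n + δ (n + 1) = 3 * δ (n + 1)`, so the total excess over
  -- `‖y‖` is at most `3 * (η / 3)`.
  set δ : ℕ → ℝ := fun n => η / 3 / 2 / 2 ^ n with hδ
  have hδpos : ∀ n, 0 < δ n := fun n => by positivity
  have hδsum : HasSum δ (η / 3) := hasSum_geometric_two' _
  let e : ℕ → H := fun n => Nat.rec y (fun n w => w - R (T w (δ n))) n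
  have he0 : e 0 = y := rfl
  have he : ∀ n, e (n + 1) = e n - R (T (e n) (δ n)) := fun n => rfl
  have hen : ∀ n, ‖e (n + 1)‖ ≤ δ n := fun n => by
    rw [he, norm_sub_rev]; exact hT _ _ (hδpos n)
  have hbound : ∀ n, ‖T (e n) (δ n)‖ ≤ (if n = 0 then ‖y‖ else 0) + 3 * δ n := by
    rintro (_ | n)
    · have : ‖T (e 0) (δ 0)‖ ≤ ‖y‖ + δ 0 := hTn (e 0) (δ 0) (hδpos 0)
      have := hδpos 0
      simp only [if_true]
      linarith
    · have h1 := hTn (e (n + 1)) (δ (n + 1)) (hδpos _)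
      have h2 : δ n = 2 * δ (n + 1) := by simp only [hδ, pow_succ]; field_simp
      have := hen n
      simp only [Nat.succ_ne_zero, if_false]
      linarith
  have hbsum : HasSum (fun n => (if n = 0 then ‖y‖ else 0) + 3 * δ n) (‖y‖ + η) := by
    have := (hasSum_ite_eq 0 ‖y‖).add (hδsum.mul_left 3)
    rwa [mul_div_cancel₀ _ three_ne_zero] at this
  have hsum : Summable fun n => T (e n) (δ n) := Summable.of_norm_bounded hbsum.summable hbound
  have htend := hsum.hasSum.tendsto_sum_nat
  refine ⟨∑' n, T (e n) (δ n), ?_, ?_, tsum_of_norm_bounded hbsum hbound⟩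
  · exact hA.mem_of_tendsto htend
      (Eventually.of_forall fun n => A.sum_mem fun i _ => hTA _ _ (hδpos i))
  · have hpart : ∀ n, R (∑ i ∈ Finset.range n, T (e i) (δ i)) = y - e n := by
      intro n
      induction n with
      | zero => simp [he0]
      | succ n ih => rw [Finset.sum_range_succ, map_add, ih, he]; abel
    have hlim : Tendsto e atTop (𝓝 0) := by
      rw [← tendsto_add_atTop_iff_nat 1]
      exact squeeze_zero_norm hen hδsum.summable.tendsto_atTop_zero
    have h1 := (hR.tendsto _).comp htend
    refine tendsto_nhds_unique h1 ?_
    have : (R ∘ fun n => ∑ i ∈ Finset.range n, T (e i) (δ i)) = fun n => y - e n := funext hpart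
    rw [this]
    simpa using tendsto_const_nhds.sub hlim

/-! ### The disk algebra and restriction to `E` -/

theorem mem_diskAlgebra_of_differentiableOn {g : C(closedBall (0 : ℂ) 1, ℂ)} {G : ℂ → ℂ}
    (hG : DifferentiableOn ℂ G (ball 0 1)) (h : ∀ z, g z = G z) : g ∈ diskAlgebra :=
  ⟨G, hG.analyticOnNhd isOpen_ball, fun z _ => h z⟩

theorem differentiableOn_of_mem_diskAlgebra {g : C(closedBall (0 : ℂ) 1, ℂ)}
    (hg : g ∈ diskAlgebra) :
    DifferentiableOn ℂ (Function.extend Subtype.val g 0) (ball 0 1) := by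
  obtain ⟨G, hG, h⟩ := hg
  refine hG.differentiableOn.congr fun z hz => ?_
  have := Subtype.val_injective.extend_apply g 0 (⟨z, ball_subset_closedBall hz⟩ : closedBall _ _)
  exact this.trans (h _ hz)

/-- Uniform limits of holomorphic functions are holomorphic (Weierstrass). -/
theorem isClosed_diskAlgebra : IsClosed (diskAlgebra : Set C(closedBall (0 : ℂ) 1, ℂ)) := by
  rw [← isSeqClosed_iff_isClosed]
  intro u g hu hlim
  refine mem_diskAlgebra_of_differentiableOn (G := Function.extend Subtype.val g 0) ?_
    fun z => (Subtype.val_injective.extend_apply g 0 z).symm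
  have hunif : TendstoUniformlyOn (fun n => Function.extend Subtype.val (u n) (0 : ℂ → ℂ))
      (Function.extend Subtype.val g 0) atTop (ball (0 : ℂ) 1) := by
    rw [ContinuousMap.tendsto_iff_tendstoUniformly, Metric.tendstoUniformly_iff] at hlim
    rw [Metric.tendstoUniformlyOn_iff]
    intro ε hε
    filter_upwards [hlim ε hε] with n hn z hz
    lift z to closedBall (0 : ℂ) 1 using ball_subset_closedBall hz
    rw [Subtype.val_injective.extend_apply, Subtype.val_injective.extend_apply]
    exact hn z
  exact hunif.tendstoLocallyUniformlyOn.differentiableOn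
    (Eventually.of_forall fun n => differentiableOn_of_mem_diskAlgebra (hu n)) isOpen_ball

/-- A function which is holomorphic on the closed disk, as an element of `C(closedBall 0 1, ℂ)`. -/
theorem exists_mem_diskAlgebra_of_differentiableOn {h : ℂ → ℂ}
    (hh : DifferentiableOn ℂ h (closedBall 0 1)) : ∃ g ∈ diskAlgebra, ∀ z, g z = h z :=
  ⟨⟨_, hh.continuousOn.domRestrict⟩,
    mem_diskAlgebra_of_differentiableOn (hh.mono ball_subset_closedBall) fun _ => rfl, fun _ => rfl⟩

/-- The restriction map from the closed disk to a subset of the circle. -/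
noncomputable def restrictCircle {E : Set ℂ} (hET : E ⊆ sphere (0 : ℂ) 1) :
    C(closedBall (0 : ℂ) 1, ℂ) →ₐ[ℂ] C(E, ℂ) :=
  ContinuousMap.compRightAlgHom ℂ ℂ
    ⟨Set.inclusion (hET.trans sphere_subset_closedBall), continuous_inclusion _⟩

theorem restrictCircle_apply {E : Set ℂ} (hET : E ⊆ sphere (0 : ℂ) 1)
    (g : C(closedBall (0 : ℂ) 1, ℂ)) (z : E) :
    restrictCircle hET g z = g ⟨z, sphere_subset_closedBall (hET z.2)⟩ := rfl

theorem continuous_restrictCircle {E : Set ℂ} (hET : E ⊆ sphere (0 : ℂ) 1) :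
    Continuous (restrictCircle hET) :=
  ContinuousMap.continuous_precomp _

/-! ### Density on a proper closed subset of the circle -/

/-- Moving the pole from `a` out to `(1 + t)a` puts the function in the disk algebra, at a cost of
at most `t * ‖v‖ ^ 2` on `E`. -/
theorem inv_one_sub_mul_conj_mem_closure {E : Set ℂ} [CompactSpace E] (hET : E ⊆ sphere (0 : ℂ) 1)
    {a : ℂ} (ha : a ∈ sphere (0 : ℂ) 1) {v : C(E, ℂ)} (hv : ∀ z : E, v z = (1 - z * conj a)⁻¹)
    (haE : a ∉ E) : v ∈ (diskAlgebra.map (restrictCircle hET)).topologicalClosure := by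
  have ha1 : ‖a‖ = 1 := by simpa using ha
  have hpos : ∀ z : E, (1 : ℂ) - z * conj a ≠ 0 := fun z h => by
    have h1 := norm_one_sub_mul_conj z ha1
    rw [h, norm_zero, eq_comm, norm_sub_eq_zero_iff] at h1
    exact haE (h1 ▸ z.2)
  have key : ∀ t : ℝ, 0 < t → ∃ g ∈ diskAlgebra, ∀ z, g z = ((t : ℂ) + (1 - z * conj a))⁻¹ := by
    intro t ht
    refine exists_mem_diskAlgebra_of_differentiableOn
      (h := fun z => ((t : ℂ) + (1 - z * conj a))⁻¹) ?_
    refine DifferentiableOn.inv (by fun_prop) fun z hz h0 => ?_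
    have h1 := one_sub_re_mul_conj_nonneg (by simpa using hz) ha1
    have h2 := congrArg Complex.re h0
    rw [Complex.add_re, Complex.ofReal_re, Complex.zero_re] at h2
    linarith
  choose! g hgA hg using key
  have hvb : ∀ z : E, ∀ t : ℝ, 0 < t → ‖restrictCircle hET (g t) z - v z‖ ≤ t * ‖v‖ ^ 2 := by
    intro z t ht
    have hre : 0 ≤ ((1 : ℂ) - z * conj a).re :=
      one_sub_re_mul_conj_nonneg (by simpa using (hET z.2).le) ha1
    have hle : ‖(1 : ℂ) - z * conj a‖ ≤ ‖(t : ℂ) + (1 - z * conj a)‖ := by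
      rw [← sq_le_sq₀ (norm_nonneg _) (norm_nonneg _), Complex.sq_norm, Complex.sq_norm,
        Complex.normSq_apply, Complex.normSq_apply, Complex.add_re, Complex.add_im,
        Complex.ofReal_re, Complex.ofReal_im]
      nlinarith
    have h0 : 0 < ‖(1 : ℂ) - z * conj a‖ := norm_pos_iff.2 (hpos z)
    have hne : (t : ℂ) + (1 - z * conj a) ≠ 0 := norm_pos_iff.1 (h0.trans_le hle)
    have hvz : ‖(1 : ℂ) - z * conj a‖⁻¹ ≤ ‖v‖ := by
      rw [← norm_inv, ← hv]; exact v.norm_coe_le_norm z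
    rw [restrictCircle_apply, hg t ht, hv, inv_sub_inv hne (hpos z), norm_div, norm_mul]
    have h3 : ‖(1 : ℂ) - z * conj a - (t + (1 - z * conj a))‖ = t := by
      rw [sub_add_cancel_right, norm_neg, Complex.norm_real, Real.norm_of_nonneg ht.le]
    rw [h3, div_eq_mul_inv, mul_inv, sq]
    gcongr
    exact (inv_anti₀ h0 hle).trans hvz
  refine Metric.mem_closure_iff.2 fun ε hε => ?_
  set t : ℝ := ε / (‖v‖ ^ 2 + 1) / 2
  have ht : 0 < t := by positivity
  refine ⟨restrictCircle hET (g t), ⟨g t, hgA t ht, rfl⟩, ?_⟩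
  rw [dist_comm, dist_eq_norm]
  refine ((ContinuousMap.norm_le _ (by positivity)).2 fun z => hvb z t ht).trans_lt ?_
  calc t * ‖v‖ ^ 2 < t * (‖v‖ ^ 2 + 1) * 2 := by nlinarith [sq_nonneg ‖v‖]
    _ = ε := by simp only [t]; field_simp

/-- The disk algebra is dense in the continuous functions on a proper closed subset of the
circle. -/
theorem topologicalClosure_map_restrictCircle {E : Set ℂ} [CompactSpace E]
    (hET : E ⊆ sphere (0 : ℂ) 1) {a : ℂ} (ha : a ∈ sphere (0 : ℂ) 1) (haE : a ∉ E) :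
    (diskAlgebra.map (restrictCircle hET)).topologicalClosure = ⊤ := by
  have ha1 : ‖a‖ = 1 := by simpa using ha
  have hpos : ∀ z : E, (1 : ℂ) - z * conj a ≠ 0 := fun z h => by
    have h1 := norm_one_sub_mul_conj z ha1
    rw [h, norm_zero, eq_comm, norm_sub_eq_zero_iff] at h1
    exact haE (h1 ▸ z.2)
  let v : C(E, ℂ) := ⟨fun z => (1 - z * conj a)⁻¹, Continuous.inv₀ (by fun_prop) hpos⟩
  have hv : ∀ z : E, v z = (1 - z * conj a)⁻¹ := fun _ => rfl
  set B := (diskAlgebra.map (restrictCircle hET)).topologicalClosure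
  have hvB : v ∈ B := inv_one_sub_mul_conj_mem_closure hET ha hv haE
  -- The function `v` maps the circle minus `a` into the line `Re w = 1/2`, so conjugation stays
  -- within the algebra generated by `v`.
  have hstar : star v = 1 - v := by
    ext z
    have hz1 : ‖(z : ℂ)‖ = 1 := by simpa using hET z.2
    have h1 : (z : ℂ) * conj (z : ℂ) = 1 := by rw [Complex.mul_conj', hz1]; simp
    have h2 : a * conj a = 1 := by rw [Complex.mul_conj', ha1]; simp
    have h3 := hpos z
    have h4 : (1 : ℂ) - conj (z : ℂ) * a ≠ 0 := fun h => h3 (by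
      have := congrArg conj h
      simpa using this)
    change conj ((1 - (z : ℂ) * conj a)⁻¹) = 1 - (1 - (z : ℂ) * conj a)⁻¹
    rw [map_inv₀, map_sub, map_mul, map_one, Complex.conj_conj]
    field_simp
    linear_combination -(a * conj a) * h1 - h2
  let S := StarAlgebra.adjoin ℂ {v}
  have hS : S.toSubalgebra ≤ B := by
    rw [StarAlgebra.adjoin_toSubalgebra, Algebra.adjoin_le_iff, Set.star_singleton]
    rintro x (rfl | rfl)
    · exact hvB
    · rw [hstar]; exact B.sub_mem B.one_mem hvB
  have hsep : S.SeparatesPoints := by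
    intro x y hxy
    refine ⟨v, ⟨v, StarAlgebra.self_mem_adjoin_singleton ℂ v, rfl⟩, fun h => hxy ?_⟩
    rw [hv, hv, inv_inj, sub_right_inj] at h
    have : conj a ≠ 0 := fun h0 => by simp_all
    exact Subtype.ext (mul_right_cancel₀ this h)
  have htop := ContinuousMap.starSubalgebra_topologicalClosure_eq_top_of_separatesPoints S hsep
  rw [eq_top_iff]
  intro x _
  have hx : x ∈ S.topologicalClosure := htop ▸ StarSubalgebra.mem_top
  exact Subalgebra.topologicalClosure_minimal hS (Subalgebra.isClosed_topologicalClosure _) hx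

/-! ### Norm-controlled approximation and the theorem -/

theorem exists_mem_diskAlgebra_approx {E : Set ℂ} [CompactSpace E] (hET : E ⊆ sphere (0 : ℂ) 1)
    (hE : IsClosed E) (hE0 : circleLebesgue E = 0) (f : C(E, ℂ)) {δ : ℝ} (hδ : 0 < δ) :
    ∃ g ∈ diskAlgebra, ‖restrictCircle hET g - f‖ ≤ δ ∧ ‖g‖ ≤ ‖f‖ + δ := by
  obtain ⟨a, ha, haE⟩ := exists_mem_sphere_notMem hE0
  have hf : f ∈ (diskAlgebra.map (restrictCircle hET)).topologicalClosure :=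
    topologicalClosure_map_restrictCircle hET ha haE ▸ Algebra.mem_top
  obtain ⟨_, ⟨p, hpA, rfl⟩, hpf⟩ := Metric.mem_closure_iff.1 hf (δ / 2) (by positivity)
  have hpE : ∀ z : E, ‖p ⟨z, sphere_subset_closedBall (hET z.2)⟩ - f z‖ ≤ δ / 2 := by
    intro z
    rw [dist_comm, dist_eq_norm] at hpf
    exact ((restrictCircle hET p - f).norm_coe_le_norm z).trans hpf.le
  have hpu := CompactSpace.uniformContinuous_of_continuous p.continuous
  obtain ⟨d, hd, hpd⟩ := Metric.uniformContinuous_iff.1 hpu (δ / 2) (by positivity)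
  set ε : ℝ := δ / 2 / (‖p‖ + 1) with hε
  have hεp : ‖p‖ * ε ≤ δ / 2 := by
    rw [hε, mul_div_assoc', div_le_iff₀ (by positivity)]
    nlinarith [norm_nonneg p]
  obtain ⟨h, hhd, hh1, hhE, hhfar⟩ := exists_peak hET hE hE0 hd (ε := ε) (by positivity)
  obtain ⟨k, hkA, hk⟩ := exists_mem_diskAlgebra_of_differentiableOn hhd
  refine ⟨p * k, diskAlgebra.mul_mem hpA hkA, ?_, ?_⟩
  · refine (ContinuousMap.norm_le _ hδ.le).2 fun z => ?_
    set w : closedBall (0 : ℂ) 1 := ⟨z, sphere_subset_closedBall (hET z.2)⟩ with hw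
    have h1 : (restrictCircle hET (p * k) - f) z = p w * (h z - 1) + (p w - f z) := by
      rw [ContinuousMap.sub_apply, restrictCircle_apply, ContinuousMap.mul_apply, hk]
      ring
    rw [h1]
    refine (norm_add_le _ _).trans ?_
    rw [norm_mul]
    have h2 : ‖p w‖ * ‖h z - 1‖ ≤ ‖p‖ * ε :=
      mul_le_mul (p.norm_coe_le_norm w) (hhE z z.2) (norm_nonneg _) (norm_nonneg _)
    linarith [hpE z]
  · refine (ContinuousMap.norm_le _ (by positivity)).2 fun z => ?_
    rw [ContinuousMap.mul_apply, hk, norm_mul]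
    -- Far from `E` the factor `h` beats `‖p‖`; within `d` of some `ζ ∈ E`, `p z` is within `δ / 2`
    -- of `p ζ`, itself within `δ / 2` of `f ζ`.
    by_cases hfar : ∀ ζ ∈ E, d ≤ ‖(z : ℂ) - ζ‖
    · have h2 : ‖p z‖ * ‖h z‖ ≤ ‖p‖ * ε :=
        mul_le_mul (p.norm_coe_le_norm z) (hhfar z z.2 hfar) (norm_nonneg _) (norm_nonneg _)
      linarith [norm_nonneg f]
    · push Not at hfar
      obtain ⟨ζ, hζ, hzζ⟩ := hfar
      have h1 := hpE ⟨ζ, hζ⟩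
      have h2 := hpd (a := z) (b := ⟨ζ, sphere_subset_closedBall (hET hζ)⟩)
        (by rwa [Subtype.dist_eq, dist_eq_norm])
      rw [dist_eq_norm] at h2
      have h3 := f.norm_coe_le_norm ⟨ζ, hζ⟩
      have h4 : ‖p z‖ ≤ ‖f‖ + δ := by
        have := norm_add₃_le (a := p z - p ⟨ζ, sphere_subset_closedBall (hET hζ)⟩)
          (b := p ⟨ζ, sphere_subset_closedBall (hET hζ)⟩ - f ⟨ζ, hζ⟩) (c := f ⟨ζ, hζ⟩)
        rw [sub_add_sub_cancel, sub_add_cancel] at this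
        linarith
      exact (mul_le_of_le_one_right (norm_nonneg _) (hh1 z z.2)).trans h4

/-- The Rudin–Carleson theorem, with the bound on the extension. -/
theorem theoremB (E : Set ℂ) (hET : E ⊆ Metric.sphere (0 : ℂ) 1) (hE : IsClosed E)
    (hE0 : circleLebesgue E = 0) (f : E → ℂ) (hf : Continuous f) :
    (∃ g ∈ diskAlgebra, ∀ (z : ℂ) (hz : z ∈ E),
      g ⟨z, Metric.sphere_subset_closedBall (hET hz)⟩ = f ⟨z, hz⟩) ∧
    ∀ η : ℝ, 0 < η → ∃ g ∈ diskAlgebra,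
      (∀ (z : ℂ) (hz : z ∈ E),
        g ⟨z, Metric.sphere_subset_closedBall (hET hz)⟩ = f ⟨z, hz⟩) ∧
      ∀ z : Metric.closedBall (0 : ℂ) 1, ‖g z‖ ≤ supNorm f + η := by
  have : CompactSpace E :=
    isCompact_iff_compactSpace.1 ((isCompact_sphere 0 1).of_isClosed_subset hE hET)
  have main : ∀ η : ℝ, 0 < η → ∃ g ∈ diskAlgebra,
      (∀ (z : ℂ) (hz : z ∈ E),
        g ⟨z, Metric.sphere_subset_closedBall (hET hz)⟩ = f ⟨z, hz⟩) ∧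
      ∀ z : Metric.closedBall (0 : ℂ) 1, ‖g z‖ ≤ supNorm f + η := by
    intro η hη
    obtain ⟨g, hgA, hgf, hgn⟩ := exists_preimage_of_approx
      (A := diskAlgebra.toSubmodule.toAddSubgroup) isClosed_diskAlgebra
      (restrictCircle hET : C(closedBall (0 : ℂ) 1, ℂ) →+ C(E, ℂ)) (continuous_restrictCircle hET)
      (fun y δ hδ => exists_mem_diskAlgebra_approx hET hE hE0 y hδ) ⟨f, hf⟩ hη
    refine ⟨g, hgA, fun z hz => DFunLike.congr_fun hgf ⟨z, hz⟩, fun z => ?_⟩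
    rw [ContinuousMap.norm_eq_iSup_norm ⟨f, hf⟩] at hgn
    exact (g.norm_coe_le_norm z).trans hgn
  obtain ⟨g, hg, hgf, -⟩ := main 1 one_pos
  exact ⟨⟨g, hg, hgf⟩, main⟩
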